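/- Let $p\in\mathbb R\langle x_1,\dots,x_g\rangle$ be a polynomial of degree $d$ in $g$ noncommuting variables that is symmetric, i.e. $p=p^T$, where $T$ is the real-linear involution that reverses words and satisfies $x_j^T=x_j$. On polynomials in the $2g$ variables $(x,h)=(x_1,\dots,x_g,h_1,\dots,h_g)$ use the same involution, with also $h_j^T=h_j$. Let $p'(x)[h]$ and $p''(x)[h]$ denote the first and second formal directional derivatives of $p$ in the direction $h$. Let $\widetilde V(x)[h]$ be the column vector with entries $h_j\,m(x)$, where $1\le j\le g$ and $m$ runs through all words in $x$ of length $|m|\le d-1$; it has height $g\widetilde\nu$ with $\widetilde\nu=1+g+\cdots+g^{d-1}$. For $\lambda,\delta\in\mathbb R$ let $$p''_{\lambda,\delta}(x)[h]=p''(x)[h]+\delta\sum_{j=1}^g\sum_{|m|\le d-1}m(x)^Th_j^2\,m(x)+\lambda\,p'(x)[h]^Tp'(x)[h].$$ For $X\in(\mathbb R^{n\times n}_{sym})^g$ (a $g$-tuple of real symmetric $n\times n$ matrices) and $v\in\mathbb R^n$, the relaxed Hessian of $p$ is said to be positive at $(X,v)$ if for every $\delta>0$ there is a $\lambda>0$ such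 that $\langle p''_{\lambda,\delta}(X)[H]v,v\rangle\ge 0$ for all $H\in(\mathbb R^{n\times n}_{sym})^g$. **Theorem 1.4.** Let $X\in(\mathbb R^{n\times n}_{sym})^g$ and $v\in\mathbb R^n$. Suppose that the subspace $\{\widetilde V(X)[H]v : H\in(\mathbb R^{n\times n}_{sym})^g\}$ has codimension at most $n-1$ in $\mathbb R^{ng\widetilde\nu}$, and that the relaxed Hessian of $p$ is positive at $(X,v)$. Then $\sigma_-^{min}(p'')=0$, where $\sigma_-^{min}(q)$ is the smallest number $b$ of negative squares in a representation $q=\sum_{i=1}^{a}f_i^Tf_i-\sum_{\ell=1}^{b}k_\ell^Tk_\ell$ with noncommutative polynomials $f_i,k_\ell$ in $(x,h)$. Hence $p$ is matrix convex, i.e. $p(tY+(1-t)Z)\preceq t\,p(Y)+(1-t)\,p(Z)$ for all $N\ge 1$, all $Y,Z\in(\mathbb R^{N\times N}_{sym})^g$ and all $0\le t\le 1$, and $p$ has degree at most two. -/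

import Mathlib

/-!
Noncommutative (nc) polynomials in `g` symmetric variables are elements of `FreeAlgebra ℝ (Fin g)`;
the involution is Mathlib's `star` on the free algebra, which reverses words and fixes the variables.
Polynomials in `(x, h)` live in `FreeAlgebra ℝ (Fin g ⊕ Fin g)`: `Sum.inl j` is the index of `x_j`
and `Sum.inr j` is the index of `h_j`.
-/

namespace NCPoly

noncomputable section

/-- The degree of an nc polynomial: the maximal length of a word that occurs with a nonzero
coefficient (and `0` for the zero polynomial). -/
def degree {σ : Type*} (p : FreeAlgebra ℝ σ) : ℕ :=
  (FreeAlgebra.equivMonoidAlgebraFreeMonoid p).coeff.support.sup FreeMonoid.length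

/-- Evaluation of an nc polynomial at a tuple of `n × n` matrices. -/
def eval {σ : Type*} {n : ℕ} (X : σ → Matrix (Fin n) (Fin n) ℝ) (p : FreeAlgebra ℝ σ) :
    Matrix (Fin n) (Fin n) ℝ :=
  FreeAlgebra.lift ℝ X p

/-- Evaluation of an nc polynomial in `(x, h)` at `(X, H)`. -/
def evalXH {g n : ℕ} (X H : Fin g → Matrix (Fin n) (Fin n) ℝ)
    (q : FreeAlgebra ℝ (Fin g ⊕ Fin g)) : Matrix (Fin n) (Fin n) ℝ :=
  eval (Sum.elim X H) q

/-- The space of `g`-tuples of real symmetric `n × n` matrices. -/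
def SymTuple (g n : ℕ) : Set (Fin g → Matrix (Fin n) (Fin n) ℝ) :=
  {X | ∀ j, (X j).IsSymm}

/-- The variable `x_j` as a polynomial in `(x, h)`. -/
def xVar {g : ℕ} (j : Fin g) : FreeAlgebra ℝ (Fin g ⊕ Fin g) := FreeAlgebra.ι ℝ (Sum.inl j)

/-- The variable `h_j` as a polynomial in `(x, h)`. -/
def hVar {g : ℕ} (j : Fin g) : FreeAlgebra ℝ (Fin g ⊕ Fin g) := FreeAlgebra.ι ℝ (Sum.inr j)

/-- A polynomial in `x` viewed as a polynomial in `(x, h)`. -/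
def incl {g : ℕ} : FreeAlgebra ℝ (Fin g) →ₐ[ℝ] FreeAlgebra ℝ (Fin g ⊕ Fin g) :=
  FreeAlgebra.lift ℝ xVar

/-- The substitution `x_j ↦ x_j + t h_j`, `h_j ↦ h_j`, computed modulo `t ^ 2`, that is, with values
in the dual numbers over `ℝ⟨x, h⟩`. -/
def shift {g : ℕ} :
    FreeAlgebra ℝ (Fin g ⊕ Fin g) →ₐ[ℝ] DualNumber (FreeAlgebra ℝ (Fin g ⊕ Fin g)) :=
  FreeAlgebra.lift ℝ (Sum.elim
    (fun j => TrivSqZeroExt.inl (xVar j) + TrivSqZeroExt.inr (hVar j))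
    (fun j => TrivSqZeroExt.inl (hVar j)))

/-- The directional derivative in the direction `h` of a polynomial in `(x, h)`, with the variables
`h` held fixed: the coefficient of `t` in `q(x + t h)[h]`. -/
def dirDeriv {g : ℕ} (q : FreeAlgebra ℝ (Fin g ⊕ Fin g)) : FreeAlgebra ℝ (Fin g ⊕ Fin g) :=
  (shift q).snd

/-- The first derivative `p'(x)[h]`. -/
def deriv1 {g : ℕ} (p : FreeAlgebra ℝ (Fin g)) : FreeAlgebra ℝ (Fin g ⊕ Fin g) :=
  dirDeriv (incl p)

/-- The Hessian `p''(x)[h]`. -/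
def hessian {g : ℕ} (p : FreeAlgebra ℝ (Fin g)) : FreeAlgebra ℝ (Fin g ⊕ Fin g) :=
  dirDeriv (dirDeriv (incl p))

/-- The index set of the border vector with words of length less than `d`: a word `m` in `g` letters
of length `k < d`, together with an index `j`. It has `g (1 + g + ⋯ + g ^ (d - 1))` elements. -/
abbrev BorderIdx (g d : ℕ) : Type := (Σ k : Fin d, (Fin k → Fin g)) × Fin g

/-- The border vector `Ṽ(x)[h]`; its entries are `h_j m(x)` with `|m| < d`. -/
def border {g d : ℕ} (i : BorderIdx g d) : FreeAlgebra ℝ (Fin g ⊕ Fin g) :=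
  hVar i.2 * (List.ofFn fun s => xVar (i.1.2 s)).prod

/-- The relaxed Hessian `p''(x)[h] + δ Ṽ(x)[h]ᵀ Ṽ(x)[h] + lam p'(x)[h]ᵀ p'(x)[h]`, where the border
vector `Ṽ` involves the words of length at most `deg p - 1`. -/
def relaxedHessian {g : ℕ} (p : FreeAlgebra ℝ (Fin g)) (lam δ : ℝ) :
    FreeAlgebra ℝ (Fin g ⊕ Fin g) :=
  hessian p + δ • (∑ i : BorderIdx g (degree p), star (border i) * border i)
    + lam • (star (deriv1 p) * deriv1 p)

/-- The relaxed Hessian of `p` is positive at `(X, v)`. -/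
def RelaxedHessianPositiveAt {g n : ℕ} (p : FreeAlgebra ℝ (Fin g))
    (X : Fin g → Matrix (Fin n) (Fin n) ℝ) (v : Fin n → ℝ) : Prop :=
  ∀ δ : ℝ, 0 < δ → ∃ lam : ℝ, 0 < lam ∧ ∀ H ∈ SymTuple g n,
    0 ≤ (evalXH X H (relaxedHessian p lam δ)).mulVec v ⬝ᵥ v

/-- The vector `Ṽ(X)[H]v`, an element of the space `(ℝ ^ n) ^ (g ν̃)`. -/
def borderEval {g n : ℕ} (d : ℕ) (X H : Fin g → Matrix (Fin n) (Fin n) ℝ) (v : Fin n → ℝ) :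
    BorderIdx g d → Fin n → ℝ :=
  fun i => (evalXH X H (border i)).mulVec v

theorem borderEval_apply {g n : ℕ} (d : ℕ) (X H : Fin g → Matrix (Fin n) (Fin n) ℝ)
    (v : Fin n → ℝ) (i : BorderIdx g d) :
    borderEval d X H v i = (H i.2 * (List.ofFn fun s => X (i.1.2 s)).prod).mulVec v := by
  simp only [borderEval, evalXH, eval, border, hVar, map_mul, FreeAlgebra.lift_ι_apply,
    Sum.elim_inr, map_list_prod, List.map_ofFn]
  congr 4
  funext s
  simp [xVar]

/-- The subspace `{Ṽ(X)[H]v : H a g-tuple of symmetric n × n matrices}` of `(ℝ ^ n) ^ (g ν̃)`. -/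
def borderSpace {g n : ℕ} (d : ℕ) (X : Fin g → Matrix (Fin n) (Fin n) ℝ) (v : Fin n → ℝ) :
    Submodule ℝ (BorderIdx g d → Fin n → ℝ) where
  carrier := {w | ∃ H ∈ SymTuple g n, borderEval d X H v = w}
  zero_mem' := ⟨0, fun _ => Matrix.isSymm_zero, by
    funext i; simp [borderEval_apply]⟩
  add_mem' := by
    rintro _ _ ⟨H, hH, rfl⟩ ⟨K, hK, rfl⟩
    refine ⟨H + K, fun j => (hH j).add (hK j), ?_⟩
    funext i
    simp [borderEval_apply, add_mul, Matrix.add_mulVec]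
  smul_mem' := by
    rintro c _ ⟨H, hH, rfl⟩
    refine ⟨c • H, fun j => (hH j).smul c, ?_⟩
    funext i
    simp [borderEval_apply, Matrix.smul_mulVec]

/-- `IsSDS q a b`: the polynomial `q` is a sum of `a` squares minus a sum of `b` squares, a square
being a polynomial of the form `fᵀ f`. -/
def IsSDS {σ : Type*} (q : FreeAlgebra ℝ σ) (a b : ℕ) : Prop :=
  ∃ (f : Fin a → FreeAlgebra ℝ σ) (k : Fin b → FreeAlgebra ℝ σ),
    q = ∑ i, star (f i) * f i - ∑ i, star (k i) * k i

/-- The least number of negative squares in a representation of `q` as a sum and difference of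
squares (`⊤` if there were no such representation at all). -/
def sigmaMinusMin {σ : Type*} (q : FreeAlgebra ℝ σ) : ℕ∞ :=
  ⨅ b ∈ {b : ℕ | ∃ a, IsSDS q a b}, (b : ℕ∞)

/-- Matrix convexity of an nc polynomial, over symmetric matrices of all sizes; the inequality is in
the Loewner order. -/
def MatrixConvex {g : ℕ} (p : FreeAlgebra ℝ (Fin g)) : Prop :=
  ∀ n : ℕ, ∀ X ∈ SymTuple g n, ∀ Y ∈ SymTuple g n, ∀ t : ℝ, 0 ≤ t → t ≤ 1 →
    (t • eval X p + (1 - t) • eval Y p - eval (t • X + (1 - t) • Y) p).PosSemidef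

end

end NCPoly

namespace NCPoly

noncomputable section

/-! At fixed `X` and `v`, the values of `p'` and `p''` in direction `H` depend only on the border
vector with entries `H_j m(X) v`: the first is a linear function of it (`derivForm`), the second a
quadratic form (`hessForm`). Both make sense on arbitrary vectors, attained or not. With `d` the
degree of `p`, the linear function sees words `m` of length at most `d - 1`, the quadratic form only
those of length at most `d - 2`.

If `c ≠ 0` is the coefficient of a word `j :: m` of length `d`, the linear function acts on the
entry at `(j, m)` as `c` times the identity. So any linear family `L` of vectors parametrized by `ℝ
^ n` can be corrected at that entry to make the first derivative vanish, without changing the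
quadratic form. As the border space has codimension less than `n`, some corrected vector with `u ≠
0` is attained by a symmetric `H`. There the `lam` term vanishes, and letting `δ` tend to `0` gives
`hessForm ≥ 0` at `L u` (`exists_hessForm_nonneg`).

Two choices of `L` finish. If `d ≥ 3`, a top-degree word couples a short entry to a long one whose
own diagonal block vanishes, so the form can be made negative definite on a family, a contradiction
(`degree_le_two`). If `d ≤ 2`, the family `a j • u` shows that the matrix of quadratic coefficients
is positive semidefinite; factoring it gives both conclusions. -/

/-! ### Words, coefficients and degree. -/

/-- The monomial of a word. -/
def word {σ : Type*} (w : List σ) : FreeAlgebra ℝ σ := (w.map (FreeAlgebra.ι ℝ)).prod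

theorem word_nil {σ : Type*} : word ([] : List σ) = 1 := rfl

theorem word_cons {σ : Type*} (j : σ) (w : List σ) :
    word (j :: w) = FreeAlgebra.ι ℝ j * word w := by
  simp [word]

theorem star_smul_real {σ : Type*} (c : ℝ) (q : FreeAlgebra ℝ σ) : star (c • q) = c • star q := by
  rw [Algebra.smul_def, star_mul, FreeAlgebra.star_algebraMap, Algebra.smul_def, Algebra.commutes]

theorem star_word {σ : Type*} (w : List σ) : star (word w) = word w.reverse := by
  induction w with
  | nil => simp [word_nil]
  | cons j w ih =>
    rw [word_cons, star_mul, ih]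
    simp [word]

/-- The coefficients of an nc polynomial, as a function of words. -/
def wordCoeff {σ : Type*} : FreeAlgebra ℝ σ →ₗ[ℝ] (List σ →₀ ℝ) :=
  (MonoidAlgebra.coeffLinearEquiv (M := FreeMonoid σ) ℝ).toLinearMap ∘ₗ
    FreeAlgebra.equivMonoidAlgebraFreeMonoid.toLinearMap

theorem degree_eq_sup {σ : Type*} (p : FreeAlgebra ℝ σ) :
    degree p = (wordCoeff p).support.sup List.length := rfl

theorem equivMonoidAlgebraFreeMonoid_word {σ : Type*} (w : List σ) :
    FreeAlgebra.equivMonoidAlgebraFreeMonoid (word w) =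
      MonoidAlgebra.single (FreeMonoid.ofList w) (1 : ℝ) := by
  induction w with
  | nil => simp [word_nil, MonoidAlgebra.one_def]
  | cons j w ih =>
    rw [word_cons, map_mul, ih, FreeMonoid.ofList_cons]
    simp [FreeAlgebra.equivMonoidAlgebraFreeMonoid, MonoidAlgebra.single_mul_single]

theorem wordCoeff_word {σ : Type*} (w : List σ) : wordCoeff (word w) = Finsupp.single w 1 := by
  have h := congrArg MonoidAlgebra.coeff (equivMonoidAlgebraFreeMonoid_word w)
  exact h

theorem eq_sum_word {σ : Type*} (p : FreeAlgebra ℝ σ) :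
    p = (wordCoeff p).sum fun w c => c • word w := by
  have hinj : Function.Injective (wordCoeff (σ := σ)) :=
    (MonoidAlgebra.coeffLinearEquiv (M := FreeMonoid σ) ℝ).injective.comp
      FreeAlgebra.equivMonoidAlgebraFreeMonoid.injective
  apply hinj
  rw [map_finsuppSum]
  simp [wordCoeff_word]

/-- Reduces statements about derivatives and evaluations, which are linear in `p`, to single words.
-/
theorem linearMap_eq_sum {σ M : Type*} [AddCommMonoid M] [Module ℝ M]
    (L : FreeAlgebra ℝ σ →ₗ[ℝ] M) (p : FreeAlgebra ℝ σ) :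
    L p = (wordCoeff p).sum fun w c => c • L (word w) := by
  conv_lhs => rw [eq_sum_word p]
  simp [map_finsuppSum]

theorem wordCoeff_star {σ : Type*} (p : FreeAlgebra ℝ σ) (w : List σ) :
    wordCoeff (star p) w = wordCoeff p w.reverse := by
  classical
  have hs : star p = (wordCoeff p).sum fun w c => c • word w.reverse := by
    conv_lhs => rw [eq_sum_word p]
    simp [Finsupp.sum, star_sum, star_smul_real, star_word]
  rw [hs, map_finsuppSum, Finsupp.sum_apply]
  simp only [map_smul, wordCoeff_word, Finsupp.smul_apply, Finsupp.single_apply, smul_eq_mul,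
    mul_ite, mul_one, mul_zero, List.reverse_eq_iff]
  rw [Finsupp.sum_ite_eq']
  simp +contextual [eq_comm]

theorem length_le_degree {σ : Type*} {p : FreeAlgebra ℝ σ} {w : List σ}
    (hw : w ∈ (wordCoeff p).support) : w.length ≤ degree p := by
  rw [degree_eq_sup]
  exact Finset.le_sup (f := List.length) hw

theorem exists_word_of_degree_pos {σ : Type*} {p : FreeAlgebra ℝ σ} (h : 0 < degree p) :
    ∃ w, wordCoeff p w ≠ 0 ∧ w.length = degree p := by
  have hne : (wordCoeff p).support.Nonempty := by
    rw [Finset.nonempty_iff_ne_empty]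
    intro he
    simp [degree_eq_sup, he] at h
  obtain ⟨w, hw, he⟩ := Finset.exists_mem_eq_sup _ hne List.length
  exact ⟨w, by simpa using hw, by rw [degree_eq_sup, he]⟩

/-- A sum over the words of a polynomial of degree at most two, when only the words of length two
contribute. -/
theorem sum_word_of_degree_le_two {g : ℕ} {M : Type*} [AddCommGroup M] [Module ℝ M]
    {p : FreeAlgebra ℝ (Fin g)} (hd : degree p ≤ 2) (F : List (Fin g) → M)
    (h0 : F [] = 0) (h1 : ∀ j, F [j] = 0) :
    ((wordCoeff p).sum fun w c => c • F w) = ∑ j, ∑ k, wordCoeff p [j, k] • F [j, k] := by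
  classical
  have hinj : Function.Injective (fun x : Fin g × Fin g => [x.1, x.2]) := by
    rintro ⟨a, b⟩ ⟨c, d⟩ h
    simpa using h
  rw [← Finset.sum_product', Finset.univ_product_univ, Finsupp.sum]
  refine Eq.trans ?_ (Finset.sum_map Finset.univ ⟨_, hinj⟩ (fun w => wordCoeff p w • F w))
  -- Both sums are compared with the sum over the union of the support and all words of length two.
  rw [Finset.sum_subset (s₂ := (wordCoeff p).support ∪
    Finset.map ⟨fun x : Fin g × Fin g => [x.1, x.2], hinj⟩ Finset.univ) Finset.subset_union_left]
  · symm
    apply Finset.sum_subset Finset.subset_union_right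
    intro w hw hw'
    by_cases hs : w ∈ (wordCoeff p).support
    · have hl := (length_le_degree hs).trans hd
      match w, hl with
      | [], _ => simp [h0]
      | [j], _ => simp [h1]
      | [j, k], _ => simp at hw'
    · simp only [Finsupp.mem_support_iff, not_not] at hs
      simp [hs]
  · intro w _ hw'
    simp only [Finsupp.mem_support_iff, not_not] at hw'
    simp [hw']

/-! ### Derivatives of words -/

theorem fst_shift {g : ℕ} (q : FreeAlgebra ℝ (Fin g ⊕ Fin g)) : (shift q).fst = q := by
  have h : (TrivSqZeroExt.fstHom ℝ (FreeAlgebra ℝ (Fin g ⊕ Fin g)) _).comp shift =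
      AlgHom.id ℝ _ := by
    ext j
    rcases j with j | j <;> simp [shift, xVar, hVar]
  exact DFunLike.congr_fun h q

@[simp] theorem dirDeriv_mul {g : ℕ} (a b : FreeAlgebra ℝ (Fin g ⊕ Fin g)) :
    dirDeriv (a * b) = a * dirDeriv b + dirDeriv a * b := by
  simp [dirDeriv, fst_shift]

@[simp] theorem dirDeriv_one {g : ℕ} : dirDeriv (1 : FreeAlgebra ℝ (Fin g ⊕ Fin g)) = 0 := by
  simp [dirDeriv]

@[simp] theorem dirDeriv_zero {g : ℕ} : dirDeriv (0 : FreeAlgebra ℝ (Fin g ⊕ Fin g)) = 0 := by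
  simp [dirDeriv]

@[simp] theorem dirDeriv_add {g : ℕ} (a b : FreeAlgebra ℝ (Fin g ⊕ Fin g)) :
    dirDeriv (a + b) = dirDeriv a + dirDeriv b := by
  simp [dirDeriv]

@[simp] theorem dirDeriv_xVar {g : ℕ} (j : Fin g) : dirDeriv (xVar j) = hVar j := by
  simp [dirDeriv, shift, xVar]

@[simp] theorem dirDeriv_hVar {g : ℕ} (j : Fin g) : dirDeriv (hVar j) = 0 := by
  simp [dirDeriv, shift, hVar]

@[simp] theorem dirDeriv_smul {g : ℕ} (c : ℝ) (a : FreeAlgebra ℝ (Fin g ⊕ Fin g)) :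
    dirDeriv (c • a) = c • dirDeriv a := by
  simp [dirDeriv]

/-- The first derivative as a linear map. -/
def derivLM {g : ℕ} : FreeAlgebra ℝ (Fin g) →ₗ[ℝ] FreeAlgebra ℝ (Fin g ⊕ Fin g) where
  toFun := deriv1
  map_add' := by simp [deriv1]
  map_smul' := by simp [deriv1]

theorem derivLM_apply {g : ℕ} (p : FreeAlgebra ℝ (Fin g)) : derivLM p = deriv1 p := rfl

/-- The Hessian as a linear map. -/
def hessianLM {g : ℕ} : FreeAlgebra ℝ (Fin g) →ₗ[ℝ] FreeAlgebra ℝ (Fin g ⊕ Fin g) where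
  toFun := hessian
  map_add' := by simp [hessian]
  map_smul' := by simp [hessian]

theorem hessianLM_apply {g : ℕ} (p : FreeAlgebra ℝ (Fin g)) : hessianLM p = hessian p := rfl

@[simp] theorem deriv1_word_nil {g : ℕ} : deriv1 (word ([] : List (Fin g))) = 0 := by
  simp [word_nil, deriv1]

@[simp] theorem deriv1_word_cons {g : ℕ} (j : Fin g) (w : List (Fin g)) :
    deriv1 (word (j :: w)) = xVar j * deriv1 (word w) + hVar j * incl (word w) := by
  simp [word_cons, deriv1, incl]

@[simp] theorem hessian_word_nil {g : ℕ} : hessian (word ([] : List (Fin g))) = 0 := by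
  simp [word_nil, hessian]

@[simp] theorem hessian_word_cons {g : ℕ} (j : Fin g) (w : List (Fin g)) :
    hessian (word (j :: w)) =
      xVar j * hessian (word w) + (2 : ℝ) • (hVar j * deriv1 (word w)) := by
  have h : ∀ q : FreeAlgebra ℝ (Fin g), hessian q = dirDeriv (deriv1 q) := fun _ => rfl
  rw [h, deriv1_word_cons, h]
  simp only [dirDeriv_add, dirDeriv_mul, dirDeriv_xVar, dirDeriv_hVar, zero_mul, add_zero, two_smul,
    add_assoc]
  rfl

/-! ### The first and second variation as forms in the border vector -/

/-- Vectors indexed by `h_j m(x)` for all words `m`. -/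
abbrev WordVec (g n : ℕ) : Type := Fin g → List (Fin g) → Fin n → ℝ

/-- The entry of a border vector at `h_j m(x)`. -/
def coord {g n : ℕ} (j : Fin g) (m : List (Fin g)) : WordVec g n →ₗ[ℝ] (Fin n → ℝ) where
  toFun y := y j m
  map_add' _ _ := rfl
  map_smul' _ _ := rfl

@[simp] theorem coord_apply {g n : ℕ} (j : Fin g) (m : List (Fin g)) (y : WordVec g n) :
    coord j m y = y j m := rfl

section Forms

variable {g n : ℕ} (X : Fin g → Matrix (Fin n) (Fin n) ℝ)

/-- The first derivative of a word, as a linear function of the border vector. -/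
def firstVar : List (Fin g) → WordVec g n →ₗ[ℝ] (Fin n → ℝ)
  | [] => 0
  | j :: m => coord j m + (X j).mulVecLin ∘ₗ firstVar m

@[simp] theorem firstVar_nil : firstVar X [] = 0 := rfl

@[simp] theorem firstVar_cons (j : Fin g) (m : List (Fin g)) (y : WordVec g n) :
    firstVar X (j :: m) y = y j m + (X j).mulVec (firstVar X m y) := rfl

/-- The second derivative of a word, as a bilinear form in the border vector; the first argument is
the reversal of the word that precedes the given one. -/
def secondVar : List (Fin g) → List (Fin g) → WordVec g n →ₗ[ℝ] WordVec g n →ₗ[ℝ] ℝ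
  | _, [] => 0
  | a, j :: m => (2 : ℝ) • (dotProductBilin ℝ ℝ).compl₁₂ (firstVar X m) (coord j a) + secondVar (j :: a) m

@[simp] theorem secondVar_nil (a : List (Fin g)) : secondVar X a [] = 0 := by
  rw [secondVar]

@[simp] theorem secondVar_cons (a : List (Fin g)) (j : Fin g) (m : List (Fin g))
    (y z : WordVec g n) :
    secondVar X a (j :: m) y z = 2 * (firstVar X m y ⬝ᵥ z j a) + secondVar X (j :: a) m y z := by
  rw [secondVar]
  simp

theorem firstVar_congr {w : List (Fin g)} {y y' : WordVec g n}
    (h : ∀ j m, m.length < w.length → y j m = y' j m) : firstVar X w y = firstVar X w y' := by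
  induction w with
  | nil => simp
  | cons i w ih =>
    rw [firstVar_cons, firstVar_cons, ih fun j m hm => h j m (by simp; omega), h i w (by simp)]

/-- Two letters of the full word are spent on the two `h`'s, so at most the remaining ones can occur
in `m`. -/
theorem secondVar_congr {a w : List (Fin g)} {y y' z z' : WordVec g n}
    (h : ∀ j m, m.length + 2 ≤ a.length + w.length → y j m = y' j m)
    (h' : ∀ j m, m.length + 2 ≤ a.length + w.length → z j m = z' j m) :
    secondVar X a w y z = secondVar X a w y' z' := by
  induction w generalizing a with
  | nil => simp
  | cons i w ih =>
    cases w with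
    | nil => simp
    | cons k w =>
      rw [secondVar_cons, secondVar_cons X a,
        ih (a := i :: a) (fun j m hm => h j m (by simp at hm ⊢; omega))
          (fun j m hm => h' j m (by simp at hm ⊢; omega)),
        firstVar_congr X (y := y) (y' := y') (fun j m hm => h j m (by simp at hm ⊢; omega)),
        h' i a (by simp)]

variable (p : FreeAlgebra ℝ (Fin g))

/-- The first derivative of a polynomial, as a linear function of the border vector. -/
def derivForm : WordVec g n →ₗ[ℝ] (Fin n → ℝ) :=
  (wordCoeff p).sum fun w c => c • firstVar X w

theorem derivForm_apply (y : WordVec g n) :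
    derivForm X p y = (wordCoeff p).sum fun w c => c • firstVar X w y := by
  simp [derivForm, Finsupp.sum]

/-- The Hessian of a polynomial, as a bilinear form in the border vector. -/
def hessForm : WordVec g n →ₗ[ℝ] WordVec g n →ₗ[ℝ] ℝ :=
  (wordCoeff p).sum fun w c => c • secondVar X [] w

theorem hessForm_apply (y z : WordVec g n) :
    hessForm X p y z = (wordCoeff p).sum fun w c => c • secondVar X [] w y z := by
  simp [hessForm, Finsupp.sum, LinearMap.sum_apply]

theorem derivForm_congr {y y' : WordVec g n}
    (h : ∀ j m, m.length < degree p → y j m = y' j m) : derivForm X p y = derivForm X p y' := by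
  rw [derivForm_apply, derivForm_apply]
  refine Finset.sum_congr rfl fun w hw => ?_
  dsimp only
  rw [firstVar_congr X fun j m hm => h j m (hm.trans_le (length_le_degree hw))]

theorem hessForm_congr {y y' z z' : WordVec g n}
    (h : ∀ j m, m.length + 2 ≤ degree p → y j m = y' j m)
    (h' : ∀ j m, m.length + 2 ≤ degree p → z j m = z' j m) :
    hessForm X p y z = hessForm X p y' z' := by
  rw [hessForm_apply, hessForm_apply]
  refine Finset.sum_congr rfl fun w hw => ?_
  have hl := length_le_degree hw
  dsimp only
  rw [secondVar_congr X (fun j m hm => h j m (by simp at hm; omega))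
    (fun j m hm => h' j m (by simp at hm; omega))]

/-! ### Evaluation at border vectors -/

/-- The vectors `H_j m(X) v`, for all words `m`. -/
def borderVec (H : Fin g → Matrix (Fin n) (Fin n) ℝ) (v : Fin n → ℝ) : WordVec g n :=
  fun j m => (H j * (m.map X).prod).mulVec v

variable (H : Fin g → Matrix (Fin n) (Fin n) ℝ) (v : Fin n → ℝ)

/-- Evaluation at `(X, H)` as an algebra homomorphism. -/
def evalHom : FreeAlgebra ℝ (Fin g ⊕ Fin g) →ₐ[ℝ] Matrix (Fin n) (Fin n) ℝ :=
  FreeAlgebra.lift ℝ (Sum.elim X H)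

theorem evalHom_apply (q : FreeAlgebra ℝ (Fin g ⊕ Fin g)) : evalHom X H q = evalXH X H q := rfl

@[simp] theorem evalHom_xVar (j : Fin g) : evalHom X H (xVar j) = X j := by
  simp [evalHom, xVar]

@[simp] theorem evalHom_hVar (j : Fin g) : evalHom X H (hVar j) = H j := by
  simp [evalHom, hVar]

@[simp] theorem evalHom_incl_word (w : List (Fin g)) :
    evalHom X H (incl (word w)) = (w.map X).prod := by
  induction w with
  | nil => simp [word_nil]
  | cons j w ih => simp [word_cons, ih, incl_ι]
where incl_ι (j : Fin g) : incl (FreeAlgebra.ι ℝ j) = xVar j := by simp [incl]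

theorem evalHom_deriv1_word (w : List (Fin g)) :
    (evalHom X H (deriv1 (word w))).mulVec v = firstVar X w (borderVec X H v) := by
  induction w with
  | nil => simp
  | cons j w ih =>
    simp [Matrix.add_mulVec, ← ih, borderVec, add_comm]

theorem evalHom_deriv1 :
    (evalHom X H (deriv1 p)).mulVec v = derivForm X p (borderVec X H v) := by
  rw [← derivLM_apply, linearMap_eq_sum, derivForm_apply, Finsupp.sum, Finsupp.sum, map_sum,
    Matrix.sum_mulVec]
  simp [Matrix.smul_mulVec, derivLM_apply, evalHom_deriv1_word]

theorem transpose_prod_map (hX : X ∈ SymTuple g n) (a : List (Fin g)) :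
    (a.map X).prod.transpose = (a.reverse.map X).prod := by
  induction a with
  | nil => simp
  | cons j a ih => simp [ih, (hX j).eq]

/-- Everything up to and including the left `h` is moved by transposition to the other side of the
inner product; symmetry of `X` and `H` turns it into the border entry `H_j a(X) v`. The first
argument of `secondVar` thus carries the right `h`, the second the left `h`. -/
theorem evalHom_hessian_word (hX : X ∈ SymTuple g n) (hH : H ∈ SymTuple g n)
    (a w : List (Fin g)) :
    ((a.reverse.map X).prod * evalHom X H (hessian (word w))).mulVec v ⬝ᵥ v =
      secondVar X a w (borderVec X H v) (borderVec X H v) := by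
  induction w generalizing a with
  | nil => simp
  | cons j w ih =>
    rw [secondVar_cons, ← ih (j :: a), ← evalHom_deriv1_word, hessian_word_cons]
    have h : borderVec X H v j a = ((a.reverse.map X).prod * H j).transpose.mulVec v := by
      rw [Matrix.transpose_mul, transpose_prod_map X hX, (hH j).eq, List.reverse_reverse, borderVec]
    rw [h, Matrix.mulVec_transpose, dotProduct_comm _ (Matrix.vecMul _ _),
      ← Matrix.dotProduct_mulVec, Matrix.mulVec_mulVec, dotProduct_comm v]
    simp [mul_add, Matrix.add_mulVec, Matrix.smul_mulVec, mul_assoc, add_comm]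

theorem evalHom_hessian (hX : X ∈ SymTuple g n) (hH : H ∈ SymTuple g n) :
    (evalHom X H (hessian p)).mulVec v ⬝ᵥ v =
      hessForm X p (borderVec X H v) (borderVec X H v) := by
  rw [← hessianLM_apply, linearMap_eq_sum, hessForm_apply, Finsupp.sum, Finsupp.sum, map_sum,
    Matrix.sum_mulVec, sum_dotProduct]
  refine Finset.sum_congr rfl fun w _ => ?_
  rw [← evalHom_hessian_word X H v hX hH]
  simp [Matrix.smul_mulVec, hessianLM_apply]

end Forms

/-! ### The forms on vectors with a single nonzero entry. -/

section Entries

variable {g n : ℕ}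

/-- The border vector with a single nonzero entry. -/
def entry (j : Fin g) (m : List (Fin g)) : (Fin n → ℝ) →ₗ[ℝ] WordVec g n where
  toFun u i w := if i = j ∧ w = m then u else 0
  map_add' u u' := by ext i w s; by_cases h : i = j ∧ w = m <;> simp [h]
  map_smul' c u := by ext i w s; by_cases h : i = j ∧ w = m <;> simp [h]

theorem entry_apply (j : Fin g) (m : List (Fin g)) (u : Fin n → ℝ) (i : Fin g)
    (w : List (Fin g)) : entry j m u i w = if i = j ∧ w = m then u else 0 := rfl

variable (X : Fin g → Matrix (Fin n) (Fin n) ℝ)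

/-- Only a word ending in `j :: m` sees this entry, and the length bound leaves no room for letters
of `X` in front. -/
theorem firstVar_entry (j : Fin g) (m w : List (Fin g)) (u : Fin n → ℝ)
    (hw : w.length ≤ m.length + 1) :
    firstVar X w (entry j m u) = if w = j :: m then u else 0 := by
  induction w with
  | nil => simp
  | cons i w ih =>
    have hne : w ≠ j :: m := by
      rintro rfl
      simp at hw
    rw [firstVar_cons, ih (by simp at hw; omega), if_neg hne, entry_apply]
    simp

theorem secondVar_eq_zero_of_length_le_one {a w : List (Fin g)} (hw : w.length ≤ 1)
    (y z : WordVec g n) : secondVar X a w y z = 0 := by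
  match w, hw with
  | [], _ => simp
  | [i], _ => simp

theorem secondVar_entry_nil_of_ne_nil (j : Fin g) (u : Fin n → ℝ) {a : List (Fin g)} (ha : a ≠ [])
    (w : List (Fin g)) (y : WordVec g n) : secondVar X a w y (entry j [] u) = 0 := by
  induction w generalizing a with
  | nil => simp
  | cons i w ih => simp [ih (a := i :: a) (by simp), entry_apply, ha]

theorem secondVar_entry_entry_nil (j k : Fin g) (m w : List (Fin g)) (u u' : Fin n → ℝ)
    (hw : w.length ≤ m.length + 2) :
    secondVar X [] w (entry k m u) (entry j [] u') =
      if w = j :: k :: m then 2 * (u ⬝ᵥ u') else 0 := by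
  cases w with
  | nil => simp
  | cons i w =>
    rw [secondVar_cons, secondVar_entry_nil_of_ne_nil X j u' (by simp),
      firstVar_entry X k m w u (by simpa using hw), entry_apply]
    by_cases h1 : w = k :: m <;> by_cases h2 : i = j <;> simp [h1, h2]

/-- A contributing word would contain `m` on both outer sides of the two `h`'s, hence have at least
`2 |m| + 2` letters, too many when `m` is nonempty. -/
theorem secondVar_entry_self (k : Fin g) {m : List (Fin g)} (hm : m ≠ []) (a w : List (Fin g))
    (u u' : Fin n → ℝ) (hw : a.length + w.length ≤ m.length + 2) :
    secondVar X a w (entry k m u) (entry k m u') = 0 := by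
  induction w generalizing a with
  | nil => simp
  | cons i w ih =>
    rw [secondVar_cons, ih (i :: a) (by simp at hw ⊢; omega)]
    by_cases ha : a = m
    · subst ha
      have hpos := List.length_pos_of_ne_nil hm
      rw [List.length_cons] at hw
      have hne : w ≠ k :: a := by
        intro h
        have := congrArg List.length h
        rw [List.length_cons] at this
        omega
      rw [firstVar_entry X k a w u (by omega), if_neg hne]
      simp
    · simp [entry_apply, ha]

theorem secondVar_entry_nil_entry (j k : Fin g) (m a w : List (Fin g)) (u u' : Fin n → ℝ)
    (ha : a.length ≤ m.length) (hw : a.length + w.length ≤ m.length + 2) :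
    secondVar X a w (entry j [] u) (entry k m u') =
      if a.reverse ++ w = m.reverse ++ [k, j] then 2 * (u ⬝ᵥ u') else 0 := by
  induction w generalizing a with
  | nil =>
    rw [if_neg]
    · simp
    · intro h
      have := congrArg List.length h
      simp at this
      omega
  | cons i w ih =>
    rw [secondVar_cons]
    rcases ha.lt_or_eq with hlt | heq
    · have hne : a ≠ m := by
        rintro rfl
        exact lt_irrefl _ hlt
      rw [ih (i :: a) hlt (by simp at hw ⊢; omega)]
      simp [entry_apply, hne]
    -- The prefix now has the length of `m`, so the left `h` must sit at the current letter `i` and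
    -- the right one at the only letter after it.
    · have hwl : w.length ≤ 1 := by
        rw [List.length_cons] at hw
        omega
      rw [secondVar_eq_zero_of_length_le_one X hwl, firstVar_entry X j [] w u (by simpa using hwl),
        entry_apply]
      have hiff : a.reverse ++ i :: w = m.reverse ++ [k, j] ↔ a = m ∧ i = k ∧ w = [j] := by
        constructor
        · intro h
          obtain ⟨h1, h2⟩ := List.append_inj h (by simpa using heq)
          exact ⟨List.reverse_injective h1, by simpa using h2⟩
        · rintro ⟨rfl, rfl, rfl⟩
          rfl
      rw [if_congr hiff rfl rfl]
      by_cases h1 : w = [j] <;> by_cases h2 : i = k <;> by_cases h3 : a = m <;> simp [h1, h2, h3]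

variable (p : FreeAlgebra ℝ (Fin g))

theorem sum_ite_word (w₀ : List (Fin g)) (r : ℝ) (F : List (Fin g) → ℝ)
    (hF : ∀ w ∈ (wordCoeff p).support, F w = if w = w₀ then r else 0) :
    ((wordCoeff p).sum fun w c => c • F w) = wordCoeff p w₀ * r := by
  have h : ((wordCoeff p).sum fun w c => c • F w) =
      (wordCoeff p).sum fun w c => if w = w₀ then c * r else 0 := by
    refine Finset.sum_congr rfl fun w hw => ?_
    simp [hF w hw]
  rw [h, Finsupp.sum_ite_eq']
  by_cases hw : wordCoeff p w₀ = 0 <;> simp [hw]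

theorem derivForm_entry (j : Fin g) (m : List (Fin g)) (u : Fin n → ℝ)
    (hm : degree p ≤ m.length + 1) :
    derivForm X p (entry j m u) = wordCoeff p (j :: m) • u := by
  rw [derivForm_apply]
  have h : ((wordCoeff p).sum fun w c => c • firstVar X w (entry j m u)) =
      (wordCoeff p).sum fun w c => if w = j :: m then c • u else 0 := by
    refine Finset.sum_congr rfl fun w hw => ?_
    simp [firstVar_entry X j m w u ((length_le_degree hw).trans hm)]
  rw [h, Finsupp.sum_ite_eq']
  simp +contextual [eq_comm]

theorem hessForm_entry_entry_nil (j k : Fin g) (m : List (Fin g)) (u u' : Fin n → ℝ)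
    (hd : degree p ≤ m.length + 2) :
    hessForm X p (entry k m u) (entry j [] u') =
      wordCoeff p (j :: k :: m) * (2 * (u ⬝ᵥ u')) := by
  rw [hessForm_apply]
  exact sum_ite_word p _ _ _ fun w hw =>
    secondVar_entry_entry_nil X j k m w u u' ((length_le_degree hw).trans hd)

theorem hessForm_entry_self (k : Fin g) {m : List (Fin g)} (hm : m ≠ []) (u u' : Fin n → ℝ)
    (hd : degree p ≤ m.length + 2) :
    hessForm X p (entry k m u) (entry k m u') = 0 := by
  rw [hessForm_apply]
  refine Finset.sum_eq_zero fun w hw => ?_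
  dsimp only
  rw [secondVar_entry_self X k hm [] w u u' (by simpa using (length_le_degree hw).trans hd),
    smul_zero]

/-- The contributing word is the reversal of `j :: k :: m`; symmetry of `p` gives it the same
coefficient, so the two cross terms add up instead of cancelling. -/
theorem hessForm_entry_nil_entry (hp : star p = p) (j k : Fin g) (m : List (Fin g))
    (u u' : Fin n → ℝ) (hd : degree p ≤ m.length + 2) :
    hessForm X p (entry j [] u) (entry k m u') =
      wordCoeff p (j :: k :: m) * (2 * (u ⬝ᵥ u')) := by
  have hc : wordCoeff p (j :: k :: m) = wordCoeff p (m.reverse ++ [k, j]) := by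
    conv_lhs => rw [← hp, wordCoeff_star]
    simp
  rw [hessForm_apply, hc]
  refine sum_ite_word p _ _ _ fun w hw => ?_
  have h := secondVar_entry_nil_entry X j k m [] w u u' (by simp)
    (by simpa using (length_le_degree hw).trans hd)
  rw [h]
  exact if_congr (by simp) rfl rfl

/-- A bilinear form on `ℝ ^ n` is bounded above by a multiple of the Euclidean norm squared. -/
theorem exists_bilin_le (B : (Fin n → ℝ) →ₗ[ℝ] (Fin n → ℝ) →ₗ[ℝ] ℝ) :
    ∃ C : ℝ, ∀ u, B u u ≤ C * (u ⬝ᵥ u) := by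
  let e := Pi.basisFun ℝ (Fin n)
  refine ⟨∑ i, ∑ j, |B (e i) (e j)|, fun u => ?_⟩
  have hB : B u u = ∑ i, ∑ j, u i * (u j * B (e i) (e j)) := by
    conv_lhs => rw [← e.sum_repr u]
    rw [LinearMap.map_sum₂]
    refine Finset.sum_congr rfl fun i _ => ?_
    rw [map_sum]
    refine Finset.sum_congr rfl fun j _ => ?_
    simp [e, mul_left_comm]
  rw [hB, Finset.sum_mul]
  refine Finset.sum_le_sum fun i _ => ?_
  rw [Finset.sum_mul]
  refine Finset.sum_le_sum fun j _ => ?_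
  have hsq : ∀ i, u i * u i ≤ u ⬝ᵥ u := fun i =>
    Finset.single_le_sum (f := fun i => u i * u i) (fun i _ => mul_self_nonneg _)
      (Finset.mem_univ i)
  have habs : |u i * u j| ≤ u ⬝ᵥ u := by
    rw [abs_le]
    constructor <;> nlinarith [hsq i, hsq j, sq_nonneg (u i + u j), sq_nonneg (u i - u j)]
  calc u i * (u j * B (e i) (e j)) ≤ |u i * (u j * B (e i) (e j))| := le_abs_self _
    _ = |B (e i) (e j)| * |u i * u j| := by rw [← mul_assoc, abs_mul, mul_comm]
    _ ≤ _ := mul_le_mul_of_nonneg_left habs (abs_nonneg _)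

end Entries

/-! ### Consequences of positivity and small codimension. -/

section Core

variable {g n : ℕ} {p : FreeAlgebra ℝ (Fin g)} {X : Fin g → Matrix (Fin n) (Fin n) ℝ}
  {v : Fin n → ℝ}

/-- Positivity of the relaxed Hessian gives positivity of the Hessian in the directions in which the
first derivative vanishes. -/
theorem hessForm_borderVec_nonneg (hX : X ∈ SymTuple g n) (hpos : RelaxedHessianPositiveAt p X v)
    {H : Fin g → Matrix (Fin n) (Fin n) ℝ} (hH : H ∈ SymTuple g n)
    (h0 : derivForm X p (borderVec X H v) = 0) :
    0 ≤ hessForm X p (borderVec X H v) (borderVec X H v) := by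
  obtain ⟨C, hC⟩ : ∃ C, C = (evalHom X H (∑ i : BorderIdx g (degree p),
    star (border i) * border i)).mulVec v ⬝ᵥ v := ⟨_, rfl⟩
  have hδ : ∀ δ : ℝ, 0 < δ → 0 ≤ hessForm X p (borderVec X H v) (borderVec X H v) + δ * C := by
    intro δ hδ
    obtain ⟨lam, -, h⟩ := hpos δ hδ
    have h1 := h H hH
    rw [← evalHom_apply, relaxedHessian, map_add, map_add, map_smul, map_smul, Matrix.add_mulVec,
      Matrix.add_mulVec, add_dotProduct, add_dotProduct, evalHom_hessian X p H v hX hH,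
      Matrix.smul_mulVec, Matrix.smul_mulVec, smul_dotProduct, ← hC, map_mul,
      ← Matrix.mulVec_mulVec, evalHom_deriv1, h0] at h1
    simpa using h1
  by_contra! hneg
  have hpos' : 0 < 2 * (|C| + 1) := by positivity
  -- This `δ` is small enough that `δ * C` cannot compensate a negative Hessian value.
  have h2 := hδ (-(hessForm X p (borderVec X H v) (borderVec X H v)) / (2 * (|C| + 1)))
    (div_pos (by linarith) hpos')
  rw [div_mul_eq_mul_div] at h2
  have h3 : -(hessForm X p (borderVec X H v) (borderVec X H v)) * C / (2 * (|C| + 1)) <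
      -(hessForm X p (borderVec X H v) (borderVec X H v)) := by
    rw [div_lt_iff₀ hpos']
    apply mul_lt_mul_of_pos_left _ (by linarith)
    linarith [le_abs_self C, abs_nonneg C]
  linarith

/-- The restriction of a border vector to the words of length less than `d`. -/
def restrict (d : ℕ) : WordVec g n →ₗ[ℝ] (BorderIdx g d → Fin n → ℝ) where
  toFun y i := y i.2 (List.ofFn i.1.2)
  map_add' _ _ := rfl
  map_smul' _ _ := rfl

theorem eq_of_restrict_eq {d : ℕ} {y y' : WordVec g n} (h : restrict d y = restrict d y')
    (j : Fin g) (m : List (Fin g)) (hm : m.length < d) : y j m = y' j m := by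
  have h1 := congrFun h (⟨⟨m.length, hm⟩, m.get⟩, j)
  simpa only [restrict, LinearMap.coe_mk, AddHom.coe_mk, List.ofFn_get] using h1

theorem restrict_borderVec (d : ℕ) (H : Fin g → Matrix (Fin n) (Fin n) ℝ) :
    restrict d (borderVec X H v) = borderEval d X H v := by
  funext i
  rw [borderEval_apply]
  simp [restrict, borderVec, List.map_ofFn, Function.comp_def]

/-- A dimension count replaces the requirement that `L u` be an attained border vector. -/
theorem exists_hessForm_nonneg (hX : X ∈ SymTuple g n)
    (hcodim : (Module.finrank ℝ ((BorderIdx g (degree p) → Fin n → ℝ) ⧸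
      borderSpace (degree p) X v) : ℤ) ≤ (n : ℤ) - 1)
    (hpos : RelaxedHessianPositiveAt p X v) (hd : 0 < degree p)
    (L : (Fin n → ℝ) →ₗ[ℝ] WordVec g n) :
    ∃ u, u ≠ 0 ∧ 0 ≤ hessForm X p (L u) (L u) := by
  obtain ⟨w₀, hc, hlen⟩ := exists_word_of_degree_pos hd
  obtain _ | ⟨j, m⟩ := w₀
  · simp at hlen
    omega
  rw [List.length_cons] at hlen
  -- Since `|m| = degree p - 1`, this correction kills the first derivative and stays outside the
  -- range that the Hessian sees.
  let L' : (Fin n → ℝ) →ₗ[ℝ] WordVec g n :=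
    L - entry j m ∘ₗ ((wordCoeff p (j :: m))⁻¹ • derivForm X p ∘ₗ L)
  have hL' : ∀ u, L' u = L u - entry j m ((wordCoeff p (j :: m))⁻¹ • derivForm X p (L u)) :=
    fun u => rfl
  have hker : ∀ u, derivForm X p (L' u) = 0 := by
    intro u
    rw [hL', map_sub, derivForm_entry X p j m _ hlen.ge, smul_smul, mul_inv_cancel₀ hc, one_smul,
      sub_self]
  let T := (borderSpace (degree p) X v).mkQ ∘ₗ restrict (degree p) ∘ₗ L'
  have hT : LinearMap.ker T ≠ ⊥ := by
    apply LinearMap.ker_ne_bot_of_finrank_lt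
    rw [Module.finrank_fin_fun]
    omega
  obtain ⟨u, hu, hu0⟩ := (Submodule.ne_bot_iff _).1 hT
  refine ⟨u, hu0, ?_⟩
  have hmem : restrict (degree p) (L' u) ∈ borderSpace (degree p) X v := by
    simpa [T, Submodule.Quotient.mk_eq_zero] using hu
  obtain ⟨H, hH, he⟩ := hmem
  rw [← restrict_borderVec] at he
  have hagree := eq_of_restrict_eq he
  have hlow : ∀ i w, w.length + 2 ≤ degree p → borderVec X H v i w = L u i w := by
    intro i w hw
    have hne : w ≠ m := by
      rintro rfl
      omega
    rw [hagree i w (by omega), hL']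
    simp [entry_apply, hne]
  rw [← hessForm_congr X p hlow hlow]
  apply hessForm_borderVec_nonneg hX hpos hH
  rw [derivForm_congr X p hagree, hker]

theorem dotProduct_self_pos_of_ne_zero {u : Fin n → ℝ} (hu : u ≠ 0) : 0 < u ⬝ᵥ u :=
  lt_of_le_of_ne (Finset.sum_nonneg fun _ _ => mul_self_nonneg _)
    fun h => hu (dotProduct_self_eq_zero.1 h.symm)

theorem degree_le_two (hp : star p = p) (hX : X ∈ SymTuple g n)
    (hcodim : (Module.finrank ℝ ((BorderIdx g (degree p) → Fin n → ℝ) ⧸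
      borderSpace (degree p) X v) : ℤ) ≤ (n : ℤ) - 1)
    (hpos : RelaxedHessianPositiveAt p X v) : degree p ≤ 2 := by
  by_contra! hd
  obtain ⟨w, hc, hlen⟩ := exists_word_of_degree_pos (p := p) (by omega)
  match w, hc, hlen with
  | [], _, hlen => simp at hlen; omega
  | [_], _, hlen => simp at hlen; omega
  | [_, _], _, hlen => simp at hlen; omega
  | j :: k :: i :: m, hc, hlen =>
    set c := wordCoeff p (j :: k :: i :: m) with hcdef
    have hdeg : degree p ≤ (i :: m).length + 2 := by simpa using hlen.ge
    obtain ⟨C, hC⟩ := exists_bilin_le ((hessForm X p).compl₁₂ (entry j []) (entry j []))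
    -- On the family below the form is at most `(C + 4 t c) |u|²`, and `t c = -(|C| + 1)` makes this
    -- negative.
    let t : ℝ := -(|C| + 1) / c
    obtain ⟨u, hu, hnn⟩ := exists_hessForm_nonneg hX hcodim hpos (by omega)
      (entry j [] + t • entry k (i :: m))
    have hCu := hC u
    have hu' := dotProduct_self_pos_of_ne_zero hu
    simp only [LinearMap.compl₁₂_apply] at hCu
    simp only [LinearMap.add_apply, LinearMap.smul_apply, map_add, map_smul, smul_eq_mul,
      hessForm_entry_self X p k (List.cons_ne_nil i m) u u hdeg,
      hessForm_entry_nil_entry X p hp j k (i :: m) u u hdeg,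
      hessForm_entry_entry_nil X p j k (i :: m) u u hdeg, ← hcdef] at hnn
    have htc : t * c = -(|C| + 1) := div_mul_cancel₀ _ hc
    have hfin : t * (c * (2 * (u ⬝ᵥ u))) = -(|C| + 1) * (2 * (u ⬝ᵥ u)) := by
      rw [← htc]; ring
    nlinarith [mul_le_mul_of_nonneg_right (le_abs_self C) hu'.le,
      mul_nonneg (abs_nonneg C) hu'.le]

/-- The coefficients of the words of length two. -/
def quadMatrix (p : FreeAlgebra ℝ (Fin g)) : Matrix (Fin g) (Fin g) ℝ :=
  Matrix.of fun j k => wordCoeff p [j, k]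

theorem posSemidef_quadMatrix (hp : star p = p) (hX : X ∈ SymTuple g n)
    (hcodim : (Module.finrank ℝ ((BorderIdx g (degree p) → Fin n → ℝ) ⧸
      borderSpace (degree p) X v) : ℤ) ≤ (n : ℤ) - 1)
    (hpos : RelaxedHessianPositiveAt p X v) : (quadMatrix p).PosSemidef := by
  have hd := degree_le_two hp hX hcodim hpos
  refine Matrix.PosSemidef.of_dotProduct_mulVec_nonneg ?_ fun a => ?_
  · ext j k
    have h := wordCoeff_star p [j, k]
    rw [hp] at h
    simpa [quadMatrix] using h.symm
  -- In degree zero there is no top-degree letter at which to correct the first derivative.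
  by_cases hd0 : degree p = 0
  · have hq : quadMatrix p = 0 := by
      ext j k
      by_contra hne
      have := length_le_degree (p := p) (w := [j, k]) (by simpa [quadMatrix] using hne)
      simp [hd0] at this
    simp [hq]
  -- For `degree p ≤ 2` the Hessian sees only the empty word, so the entries at longer words are
  -- arbitrary.
  let L : (Fin n → ℝ) →ₗ[ℝ] WordVec g n :=
    { toFun := fun u j _ => a j • u
      map_add' := fun u u' => by
        funext j m
        exact smul_add _ _ _
      map_smul' := fun c u => by
        funext j m
        exact smul_comm _ _ _ }
  have hL : ∀ u j m, L u j m = a j • u := fun _ _ _ => rfl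
  obtain ⟨u, hu, hnn⟩ := exists_hessForm_nonneg hX hcodim hpos (by omega) L
  rw [hessForm_apply, sum_word_of_degree_le_two hd (fun w => secondVar X [] w (L u) (L u))
    (by simp) (by simp)] at hnn
  have hu' := dotProduct_self_pos_of_ne_zero hu
  have he : (∑ j, ∑ k, wordCoeff p [j, k] • secondVar X [] [j, k] (L u) (L u)) =
      (star a ⬝ᵥ (quadMatrix p).mulVec a) * (2 * (u ⬝ᵥ u)) := by
    rw [dotProduct, Finset.sum_mul]
    simp_rw [Matrix.mulVec, dotProduct.eq_def (quadMatrix p _), Finset.mul_sum, Finset.sum_mul,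
      quadMatrix]
    refine Finset.sum_congr rfl fun j _ => Finset.sum_congr rfl fun k _ => ?_
    simp only [secondVar_cons, secondVar_nil, firstVar_cons, firstVar_nil, hL, smul_dotProduct,
      dotProduct_smul, LinearMap.zero_apply, Matrix.mulVec_zero, zero_dotProduct, add_zero, mul_zero, smul_eq_mul, Pi.star_apply,
      star_trivial, Matrix.of_apply]
    ring
  rw [he] at hnn
  exact nonneg_of_mul_nonneg_left hnn (by linarith)

end Core

/-! ### Sums of squares and matrix convexity. -/

/-- A quadratic form with matrix `∑ᵢ vᵢ vᵢᵀ`, evaluated in an algebra, is a sum of squares. -/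
theorem sum_sum_vecMulVec_smul {g m : ℕ} {A : Type*} [Ring A] [Algebra ℝ A]
    (B : Fin m → Fin g → ℝ) (y : Fin g → A) :
    ∑ j, ∑ k, (∑ i, Matrix.vecMulVec (B i) (star (B i))) j k • (y j * y k) =
      ∑ i, (∑ j, B i j • y j) * (∑ j, B i j • y j) := by
  simp only [Matrix.sum_apply, Matrix.vecMulVec_apply, star_trivial, Finset.sum_smul,
    Finset.sum_mul_sum, smul_mul_smul_comm]
  rw [Finset.sum_comm (s := Finset.univ (α := Fin m)) (t := Finset.univ (α := Fin g))
    (f := fun i j => ∑ k, (B i j * B i k) • (y j * y k))]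
  exact Finset.sum_congr rfl fun j _ => Finset.sum_comm

theorem isSDS_hessian {g : ℕ} {p : FreeAlgebra ℝ (Fin g)} (hd : degree p ≤ 2)
    (hq : (quadMatrix p).PosSemidef) : ∃ a, IsSDS (hessian p) a 0 := by
  obtain ⟨m, B, hB⟩ := Matrix.posSemidef_iff_eq_sum_vecMulVec.1 hq
  -- The factor `√2` absorbs the `2` in the second derivative `2 h_j h_k` of `x_j x_k`.
  refine ⟨m, fun i => Real.sqrt 2 • ∑ j, B i j • hVar j, Fin.elim0, ?_⟩
  have hstar : ∀ (c : ℝ) (q : FreeAlgebra ℝ (Fin g ⊕ Fin g)), star (c • q) = c • star q :=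
    star_smul_real
  have h2 : Real.sqrt 2 * Real.sqrt 2 = 2 := Real.mul_self_sqrt (by norm_num)
  have hV : ∀ j : Fin g, star (hVar j) = hVar j := fun j => FreeAlgebra.star_ι _
  rw [← hessianLM_apply, linearMap_eq_sum,
    sum_word_of_degree_le_two hd (fun w => hessianLM (word w)) (by simp [hessianLM_apply])
      (by simp [hessianLM_apply])]
  have h := sum_sum_vecMulVec_smul B (hVar (g := g))
  rw [← hB] at h
  simp only [hstar, star_sum, hV, smul_mul_smul_comm, h2, ← Finset.smul_sum, ← h]
  have h1 : incl (word ([] : List (Fin g))) = 1 := by simp [word_nil]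
  simp [hessianLM_apply, quadMatrix, h1, Finset.smul_sum, smul_smul, mul_comm]

theorem matrixConvex_of_posSemidef {g : ℕ} {p : FreeAlgebra ℝ (Fin g)} (hd : degree p ≤ 2)
    (hq : (quadMatrix p).PosSemidef) : MatrixConvex p := by
  intro n Y hY Z hZ t ht0 ht1
  obtain ⟨m, B, hB⟩ := Matrix.posSemidef_iff_eq_sum_vecMulVec.1 hq
  let D : Fin g → Matrix (Fin n) (Fin n) ℝ := fun j => Y j - Z j
  have hlin : t • eval Y p + (1 - t) • eval Z p - eval (t • Y + (1 - t) • Z) p =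
      (t • (FreeAlgebra.lift ℝ Y).toLinearMap + (1 - t) • (FreeAlgebra.lift ℝ Z).toLinearMap -
        (FreeAlgebra.lift ℝ (t • Y + (1 - t) • Z)).toLinearMap) p := rfl
  have h := sum_sum_vecMulVec_smul B D
  rw [← hB] at h
  -- The convexity defect kills constant and linear terms; on `x_j x_k` it equals `t (1 - t) D_j
  -- D_k`.
  have hsum : t • eval Y p + (1 - t) • eval Z p - eval (t • Y + (1 - t) • Z) p =
      (t * (1 - t)) • ∑ i, (∑ j, B i j • D j) * (∑ j, B i j • D j) := by
    rw [hlin, linearMap_eq_sum, ← h, Finset.smul_sum]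
    rw [sum_word_of_degree_le_two hd (fun w => (t • (FreeAlgebra.lift ℝ Y).toLinearMap +
      (1 - t) • (FreeAlgebra.lift ℝ Z).toLinearMap -
        (FreeAlgebra.lift ℝ (t • Y + (1 - t) • Z)).toLinearMap) (word w))]
    · refine Finset.sum_congr rfl fun j _ => ?_
      rw [Finset.smul_sum]
      refine Finset.sum_congr rfl fun k _ => ?_
      rw [smul_comm]
      congr 1
      simp only [word_cons, word_nil, mul_one, LinearMap.sub_apply, LinearMap.add_apply,
        LinearMap.smul_apply, AlgHom.toLinearMap_apply, map_mul, FreeAlgebra.lift_ι_apply,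
        Pi.add_apply, Pi.smul_apply, D, mul_add, add_mul, mul_sub, sub_mul, smul_mul_smul_comm]
      module
    · simp only [word_nil, LinearMap.sub_apply, LinearMap.add_apply,
        LinearMap.smul_apply, AlgHom.toLinearMap_apply, map_one]
      module
    · intro j
      simp [word_cons, word_nil]
  rw [hsum]
  refine Matrix.PosSemidef.smul ?_ (mul_nonneg ht0 (by linarith))
  refine Matrix.posSemidef_sum _ fun i _ => ?_
  have hsymm : (∑ j, B i j • D j).conjTranspose = ∑ j, B i j • D j := by
    rw [Matrix.conjTranspose_sum]
    refine Finset.sum_congr rfl fun j _ => ?_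
    simp [D, Matrix.conjTranspose_eq_transpose_of_trivial, (hY j).eq, (hZ j).eq]
  conv => arg 1; arg 1; rw [← hsymm]
  exact Matrix.posSemidef_conjTranspose_mul_self _

end

end NCPoly

theorem theorem1p4 (g n : ℕ) (p : FreeAlgebra ℝ (Fin g)) (hp : star p = p)
    (X : Fin g → Matrix (Fin n) (Fin n) ℝ) (hX : X ∈ NCPoly.SymTuple g n) (v : Fin n → ℝ)
    (hcodim : (Module.finrank ℝ
      ((NCPoly.BorderIdx g (NCPoly.degree p) → Fin n → ℝ) ⧸
        NCPoly.borderSpace (NCPoly.degree p) X v) : ℤ) ≤ (n : ℤ) - 1)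
    (hpos : NCPoly.RelaxedHessianPositiveAt p X v) :
    NCPoly.sigmaMinusMin (NCPoly.hessian p) = 0 ∧
      NCPoly.MatrixConvex p ∧ NCPoly.degree p ≤ 2 := by
  have hd := NCPoly.degree_le_two hp hX hcodim hpos
  have hq := NCPoly.posSemidef_quadMatrix hp hX hcodim hpos
  refine ⟨?_, NCPoly.matrixConvex_of_posSemidef hd hq, hd⟩
  exact le_antisymm (iInf₂_le 0 (NCPoly.isSDS_hessian hd hq)) bot_le
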